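/- Let $X$ be a compact metrizable space, $d$ a metric on $X$ compatible with its topology, and $f\colon X\to X$ a homeomorphism. Suppose that (i) $(X,f)$ is expansive: there is $\delta>0$ such that for all distinct $x,y\in X$ there is $n\in\mathbb Z$ with $d(f^n(x),f^n(y))\ge\delta$; (ii) there are a finite set $A$, a topologically mixing subshift of finite type $\Sigma\subset A^{\mathbb Z}$, and a uniformly bounded-to-one factor map $\pi\colon\Sigma\to X$. Then $(X,f)$ has the Myhill property: every continuous map $\tau\colon X\to X$ that satisfies $\tau\circ f=f\circ\tau$ and is pre-injective is surjective. Here $\tau$ is pre-injective if $x=y$ whenever $\tau(x)=\tau(y)$ and $x,y\in X$ are $f$-homoclinic, i.e. $d(f^n(x),f^n(y))\to0$ as $|n|\to\infty$ $(n\in\mathbb Z)$. In (ii), $A^{\mathbb Z}$ carries the product of the discrete topologies and $\sigma(x)=(x_{i-1})_{i\in\mathbb Z}$ is the shift. A subshift is a closed set $\Sigma\subset A^{\mathbb Z}$ with $\sigma(\Sigma)=\Sigma$. It is of finite type if there are an integer $n\ge1$ and a set $P\subset A^n$ such that $\Sigma=\{x\in A^{\mathbb Z}:(x_i,x_{i+1},\dots,x_{i+n-1})\in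 P\text{ for all }i\in\mathbb Z\}$. It is topologically mixing if for all non-empty (relatively) open $U,V\subset\Sigma$ there is $N\in\mathbb Z$ such that $\sigma^n(U)\cap V\ne\emptyset$ for all $n\ge N$. The map $\pi\colon\Sigma\to X$ is a factor map if it is continuous and surjective and $\pi\circ\sigma=f\circ\pi$ on $\Sigma$; it is uniformly bounded-to-one if there is an integer $K\ge1$ such that every $x\in X$ has at most $K$ pre-images in $\Sigma$. -/

import Mathlib

namespace GardenOfEden

open Filter Topology SymbolicDynamics.FullShift

section Systems

/-- Two points `x`, `y` are `f`-homoclinic if `d(fⁿ x, fⁿ y) → 0` as `|n| → ∞`, `n ∈ ℤ`. -/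
def Homoclinic {X : Type*} [MetricSpace X] (f : X ≃ₜ X) (x y : X) : Prop :=
  Tendsto (fun n : ℤ => dist ((f ^ n) x) ((f ^ n) y)) (comap (fun n : ℤ => |n|) atTop) (𝓝 0)

/-- `(X, f)` is expansive: any two distinct points are at some time `n ∈ ℤ` at distance at
least `δ`, for a uniform constant `δ > 0`. -/
def IsExpansive {X : Type*} [MetricSpace X] (f : X ≃ₜ X) : Prop :=
  ∃ δ : ℝ, 0 < δ ∧ ∀ x y : X, x ≠ y → ∃ n : ℤ, δ ≤ dist ((f ^ n) x) ((f ^ n) y)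

/-- `(X, f)` is topologically mixing: for all non-empty open `U`, `V` there is `N ∈ ℤ` such that
`fⁿ(U)` meets `V` for all `n ≥ N`. -/
def IsTopologicallyMixing {X : Type*} [TopologicalSpace X] (f : X ≃ₜ X) : Prop :=
  ∀ U V : Set X, IsOpen U → IsOpen V → U.Nonempty → V.Nonempty →
    ∃ N : ℤ, ∀ n : ℤ, N ≤ n → ((f ^ n) '' U ∩ V).Nonempty

/-- `π` is a factor map from `(Y, g)` to `(X, f)`. -/
structure IsFactorMap {Y X : Type*} [TopologicalSpace Y] [TopologicalSpace X]
    (g : Y ≃ₜ Y) (f : X ≃ₜ X) (π : Y → X) : Prop where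
  continuous : Continuous π
  surjective : Function.Surjective π
  semiconj : ∀ y : Y, π (g y) = f (π y)

/-- There is an integer `K ≥ 1` such that every point has at most `K` pre-images under `π`. -/
def IsUniformlyBoundedToOne {Y X : Type*} (π : Y → X) : Prop :=
  ∃ K : ℕ, 1 ≤ K ∧ ∀ x : X, {y : Y | π y = x}.encard ≤ K

/-- An endomorphism of `(X, f)`: a continuous self-map commuting with `f`. -/
structure IsEndomorphism {X : Type*} [TopologicalSpace X] (f : X ≃ₜ X) (τ : X → X) : Prop where
  continuous : Continuous τ
  commute : ∀ x : X, τ (f x) = f (τ x)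

/-- `τ` is pre-injective: its restriction to each `f`-homoclinicity class is injective. -/
def IsPreInjective {X : Type*} [MetricSpace X] (f : X ≃ₜ X) (τ : X → X) : Prop :=
  ∀ x y : X, Homoclinic f x y → τ x = τ y → x = y

/-- The Myhill property: every pre-injective endomorphism is surjective. -/
def HasMyhillProperty {X : Type*} [MetricSpace X] (f : X ≃ₜ X) : Prop :=
  ∀ τ : X → X, IsEndomorphism f τ → IsPreInjective f τ → Function.Surjective τ

end Systems

section Subshifts

/-- The shift homeomorphism `σ(x) = (x_{i-1})` restricted to a subshift `S ⊆ A^ℤ`. -/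
def subshiftHomeo {A : Type*} [TopologicalSpace A] (S : Subshift A ℤ) :
    S.carrier ≃ₜ S.carrier where
  toFun x := ⟨shift (-1) x.1, S.mapsTo (-1) x.2⟩
  invFun x := ⟨shift 1 x.1, S.mapsTo 1 x.2⟩
  left_inv x := by ext i; simp
  right_inv x := by ext i; simp
  continuous_toFun := by fun_prop
  continuous_invFun := by fun_prop

/-- A check of the convention: `(σ x)_i = x_{i-1}`. -/
theorem subshiftHomeo_apply {A : Type*} [TopologicalSpace A] (S : Subshift A ℤ)
    (x : S.carrier) (i : ℤ) : (subshiftHomeo S x).1 i = x.1 (i - 1) := by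
  simp [subshiftHomeo, neg_add_eq_sub]

/-- `S` is of finite type: for some `n ≥ 1` and `P ⊆ Aⁿ`, it consists of the sequences all of
whose windows `(x_i, …, x_{i+n-1})`, `i ∈ ℤ`, lie in `P`. -/
def IsOfFiniteType {A : Type*} [TopologicalSpace A] (S : Subshift A ℤ) : Prop :=
  ∃ n : ℕ, 1 ≤ n ∧ ∃ P : Set (Fin n → A),
    S.carrier = {x : ℤ → A | ∀ i : ℤ, (fun j : Fin n => x (i + (j : ℤ))) ∈ P}

end Subshifts

end GardenOfEden

namespace GardenOfEden

open Filter Topology SymbolicDynamics.FullShift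

/-! ### Continuity read off on finite windows. -/

section Cylinders

variable {A : Type*} [TopologicalSpace A]

/-! Count orbits in a finite window. Let `τ` be pre-injective but not surjective, and `φ = τ ∘ π`.
The range of `τ` is closed and `f`-invariant, so some word `w` of a point `z` over the complement
occurs nowhere in any lift of a point of that range. Let `H` be the set of points of the subshift
that agree with `z` outside `[0, m)`. The images `π '' H` are pairwise homoclinic, so `τ` is
injective there and `φ` takes at least `|H| / K` values on `H`. Conversely, lift each such value
through `π` and glue the lift into `z`. The result lies in `H` and avoids `w` in `k` blocks; by
expansiveness it determines the value up to a factor `M` independent of `m` and `k`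
(`exists_ncard_image_windowClass_le`). Avoiding `w` costs a factor `(1 - 1/Q) ^ k`
(`pow_mul_ncard_avoidingClass_le`), which for large `k` contradicts the lower bound. Mixing and
finite type enter only through gluing with a uniform gap (`exists_hasGluing`). -/

theorem exists_agreement_subset_of_isOpen {S : Set (ℤ → A)} {U : Set S} (hU : IsOpen U)
    {x : S} (hx : x ∈ U) :
    ∃ c : ℕ, ∀ y : S, (∀ i : ℤ, |i| ≤ c → y.1 i = x.1 i) → y ∈ U := by
  obtain ⟨V, hV, rfl⟩ := isOpen_induced_iff.mp hU
  obtain ⟨I, u, hu, hIV⟩ := isOpen_pi_iff.mp hV x.1 hx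
  refine ⟨I.sup Int.natAbs, fun y hy => hIV fun i hi => ?_⟩
  have h : i.natAbs ≤ I.sup Int.natAbs := Finset.le_sup (f := Int.natAbs) hi
  rw [hy i (by rw [Int.abs_eq_natAbs]; exact_mod_cast h)]
  exact (hu i hi).2

/-- Compactness makes the radius of the window uniform in the point. -/
theorem exists_agreement_dist_lt [DiscreteTopology A] {X : Type*} [PseudoMetricSpace X]
    {S : Set (ℤ → A)} [CompactSpace S] {φ : S → X} (hφ : Continuous φ) {ε : ℝ} (hε : 0 < ε) :
    ∃ c : ℕ, ∀ x y : S, (∀ i : ℤ, |i| ≤ c → x.1 i = y.1 i) → dist (φ x) (φ y) < ε := by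
  have hc : ∀ x : S, ∃ c : ℕ, ∀ y : S, (∀ i : ℤ, |i| ≤ c → y.1 i = x.1 i) →
      dist (φ y) (φ x) < ε / 2 := fun x =>
    exists_agreement_subset_of_isOpen (U := φ ⁻¹' Metric.ball (φ x) (ε / 2))
      (Metric.isOpen_ball.preimage hφ) (by simpa using hε)
  choose c hc using hc
  have hnhds : ∀ x : S, {y : S | ∀ i : ℤ, |i| ≤ c x → y.1 i = x.1 i} ∈ 𝓝 x := fun x => by
    have ho : IsOpen (Subtype.val ⁻¹' cylinder (Finset.Icc (-(c x : ℤ)) (c x)) x.1 : Set S) :=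
      (isOpen_cylinder _ _).preimage continuous_subtype_val
    refine mem_of_superset (ho.mem_nhds fun i _ => rfl) fun y hy i hi => ?_
    exact hy i (Finset.mem_Icc.mpr (abs_le.mp hi))
  obtain ⟨t, ht⟩ := CompactSpace.elim_nhds_subcover _ hnhds
  refine ⟨t.sup c, fun x y hxy => ?_⟩
  have hx : x ∈ ⋃ z ∈ t, {y : S | ∀ i : ℤ, |i| ≤ c z → y.1 i = z.1 i} := by
    rw [ht]; trivial
  simp only [Set.mem_iUnion, exists_prop] at hx
  obtain ⟨z, hzt, hz⟩ := hx
  have hle : (c z : ℤ) ≤ (t.sup c : ℕ) := by exact_mod_cast Finset.le_sup (f := c) hzt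
  have h1 := hc z x hz
  have h2 := hc z y fun i hi => (hxy i (hi.trans hle)).symm.trans (hz i hi)
  calc dist (φ x) (φ y) ≤ dist (φ x) (φ z) + dist (φ y) (φ z) := dist_triangle_right _ _ _
    _ < ε := by linarith

end Cylinders

/-! ### Equivariance and homoclinic pairs. -/

section Iterates

theorem semiconj_zpow {Y X : Type*} [TopologicalSpace Y] [TopologicalSpace X]
    {g : Y ≃ₜ Y} {f : X ≃ₜ X} {φ : Y → X} (h : ∀ y, φ (g y) = f (φ y)) (n : ℤ) (y : Y) :
    φ ((g ^ n) y) = (f ^ n) (φ y) := by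
  induction n generalizing y with
  | zero => rfl
  | succ n ih => rw [zpow_add_one, zpow_add_one, Homeomorph.mul_apply, Homeomorph.mul_apply, ih, h]
  | pred n ih =>
    rw [zpow_sub_one, zpow_sub_one, Homeomorph.mul_apply, Homeomorph.mul_apply, ih]
    congr 1
    apply f.injective
    rw [← h, ← Homeomorph.mul_apply, ← Homeomorph.mul_apply, mul_inv_cancel, mul_inv_cancel]
    rfl

theorem subshiftHomeo_zpow_apply {A : Type*} [TopologicalSpace A] (S : Subshift A ℤ)
    (n : ℤ) (x : S.carrier) (i : ℤ) : ((subshiftHomeo S ^ n) x).1 i = x.1 (i - n) := by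
  induction n generalizing x with
  | zero => simp
  | succ n ih =>
    rw [zpow_add_one, Homeomorph.mul_apply, ih, subshiftHomeo_apply]
    exact congrArg x.1 (by ring)
  | pred n ih =>
    rw [zpow_sub_one, Homeomorph.mul_apply, ih]
    have h := subshiftHomeo_apply S ((subshiftHomeo S)⁻¹ x) (i - -n + 1)
    rw [← Homeomorph.mul_apply, mul_inv_cancel, Homeomorph.one_apply, add_sub_cancel_right] at h
    rw [← h]
    exact congrArg _ (by ring)

/-- The images of two points that agree on `[n - c, n + c]` are `ε`-close at time `-n`. -/
theorem exists_agreement_dist_zpow_lt {A : Type*} [Finite A] [TopologicalSpace A]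
    [DiscreteTopology A] (S : Subshift A ℤ) {X : Type*} [PseudoMetricSpace X] {f : X ≃ₜ X}
    {φ : S.carrier → X} (hφ : Continuous φ) (h : ∀ y, φ (subshiftHomeo S y) = f (φ y))
    {ε : ℝ} (hε : 0 < ε) :
    ∃ c : ℕ, ∀ (x y : S.carrier) (n : ℤ),
      (∀ i : ℤ, n - c ≤ i → i ≤ n + c → x.1 i = y.1 i) →
        dist ((f ^ (-n)) (φ x)) ((f ^ (-n)) (φ y)) < ε := by
  have : CompactSpace S.carrier := isCompact_iff_compactSpace.mp S.isClosed.isCompact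
  obtain ⟨c, hc⟩ := exists_agreement_dist_lt hφ hε
  refine ⟨c, fun x y n hxy => ?_⟩
  rw [← semiconj_zpow h, ← semiconj_zpow h]
  refine hc _ _ fun i hi => ?_
  rw [subshiftHomeo_zpow_apply, subshiftHomeo_zpow_apply]
  have := abs_le.mp hi
  exact hxy _ (by lia) (by lia)

theorem homoclinic_of_agreement {A : Type*} [Finite A] [TopologicalSpace A]
    [DiscreteTopology A] (S : Subshift A ℤ) {X : Type*} [MetricSpace X] {f : X ≃ₜ X}
    {φ : S.carrier → X} (hφ : Continuous φ) (h : ∀ y, φ (subshiftHomeo S y) = f (φ y))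
    {x y : S.carrier} {r : ℤ} (hxy : ∀ i : ℤ, r ≤ |i| → x.1 i = y.1 i) :
    Homoclinic f (φ x) (φ y) := by
  refine Metric.tendsto_nhds.mpr fun ε hε => ?_
  obtain ⟨c, hc⟩ := exists_agreement_dist_zpow_lt S hφ h hε
  refine (eventually_ge_atTop (r + c)).comap (fun n : ℤ => |n|) |>.mono fun n hn => ?_
  have := hc x y (-n) fun i h1 h2 => hxy i (by
    rcases abs_cases n with h | h <;> rcases abs_cases i with h' | h' <;> lia)
  rw [neg_neg] at this
  simpa using this

end Iterates

/-! ### Gluing in mixing subshifts of finite type. -/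

section Gluing

variable {A : Type*}

/-- Any left half of a point of `S` can be continued, after a gap of length `g`, by any right half
of another point of `S`. -/
def HasGluing (S : Set (ℤ → A)) (g : ℕ) : Prop :=
  ∀ x ∈ S, ∀ y ∈ S, ∀ a : ℤ, ∃ u ∈ S, (∀ i < a, u i = x i) ∧ ∀ i, a + g ≤ i → u i = y i

theorem HasGluing.exists_three {S : Set (ℤ → A)} {g : ℕ} (hS : HasGluing S g) {x y z : ℤ → A}
    (hx : x ∈ S) (hy : y ∈ S) (hz : z ∈ S) {a b : ℤ} (hab : a + g ≤ b) :
    ∃ u ∈ S, (∀ i < a, u i = x i) ∧ (∀ i, a + g ≤ i → i < b → u i = y i) ∧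
      ∀ i, b + g ≤ i → u i = z i := by
  obtain ⟨v, hv, hvy, hvz⟩ := hS y hy z hz b
  obtain ⟨u, hu, hux, huv⟩ := hS x hx v hv a
  exact ⟨u, hu, hux, fun i h1 h2 => (huv i h1).trans (hvy i h2),
    fun i hi => (huv i (by lia)).trans (hvz i hi)⟩

/-- The sequence that agrees with `x` on `(-∞, a)` and with `y` on `[a, ∞)`. -/
def splice (a : ℤ) (x y : ℤ → A) : ℤ → A := fun i => if i < a then x i else y i

theorem splice_of_lt {a i : ℤ} (x y : ℤ → A) (h : i < a) : splice a x y i = x i := if_pos h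

theorem splice_of_le {a i : ℤ} (x y : ℤ → A) (h : a ≤ i) : splice a x y i = y i :=
  if_neg (not_lt.mpr h)

/-- Points of a set defined by windows of length `n` that agree on `[a - n, a)` can be spliced
at `a`. -/
theorem splice_mem {n : ℕ} {P : Set (Fin n → A)} {x y : ℤ → A}
    (hx : ∀ i : ℤ, (fun j : Fin n => x (i + (j : ℤ))) ∈ P)
    (hy : ∀ i : ℤ, (fun j : Fin n => y (i + (j : ℤ))) ∈ P) {a : ℤ}
    (hxy : ∀ i, a - n ≤ i → i < a → x i = y i) (i : ℤ) :
    (fun j : Fin n => splice a x y (i + (j : ℤ))) ∈ P := by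
  -- A window ending before `a` is a window of `x`. Any other starts after `a - n`, where `x` and
  -- `y` agree up to `a`, so it is a window of `y`.
  rcases le_total (i + n) a with h | h
  · convert hx i using 2 with j
    have := j.isLt
    exact splice_of_lt x y (by lia)
  · convert hy i using 2 with j
    rcases lt_or_ge (i + (j : ℤ)) a with h' | h'
    · rw [splice_of_lt x y h', hxy _ (by lia) h']
    · exact splice_of_le x y h'

/-- There are finitely many pairs of words of length `n`, so one mixing time serves them all. Mixing
supplies a connecting word from `x` to `y`, and overlaps of length `n` allow splicing at both ends.
-/
theorem exists_hasGluing [Finite A] [TopologicalSpace A] [DiscreteTopology A]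
    (S : Subshift A ℤ) (hSft : IsOfFiniteType S)
    (hMix : IsTopologicallyMixing (subshiftHomeo S)) : ∃ g, HasGluing S.carrier g := by
  obtain ⟨n, -, P, hP⟩ := hSft
  let C : (Fin n → A) → Set S.carrier := fun p => {x | (fun j : Fin n => x.1 j) = p}
  have hC : ∀ p, IsOpen (C p) := fun p =>
    (isOpen_discrete {p}).preimage (f := fun (x : S.carrier) (j : Fin n) => x.1 j)
      (continuous_pi fun j => (continuous_apply (j : ℤ)).comp continuous_subtype_val)
  have hN : ∀ pq : (Fin n → A) × (Fin n → A), ∃ N : ℕ, (C pq.1).Nonempty → (C pq.2).Nonempty →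
      ∀ m : ℤ, N ≤ m → ((subshiftHomeo S ^ m) '' C pq.1 ∩ C pq.2).Nonempty := fun pq => by
    by_cases h : (C pq.1).Nonempty ∧ (C pq.2).Nonempty
    · obtain ⟨N, hN⟩ := hMix _ _ (hC _) (hC _) h.1 h.2
      exact ⟨N.toNat, fun _ _ m hm => hN m (by lia)⟩
    · exact ⟨0, fun h1 h2 => absurd ⟨h1, h2⟩ h⟩
  choose N hN using hN
  obtain ⟨g, hg⟩ := (Set.finite_range N).bddAbove
  refine ⟨g, fun x hx y hy a => ?_⟩
  have hxs := S.mapsTo (a - n) hx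
  have hys := S.mapsTo (a + g) hy
  -- On `[0, n)` the point `v` shows the word of `y` at `a + g`; on `[-(g + n), -g)` it shows the
  -- word of `x` at `a - n`.
  obtain ⟨_, ⟨v, hv, rfl⟩, hv'⟩ := hN
    (fun j => shift (a + g) y j, fun j => shift (a - n) x j)
    ⟨⟨_, hys⟩, rfl⟩ ⟨⟨_, hxs⟩, rfl⟩ (g + n) (by
      have := hg (Set.mem_range_self (fun j : Fin n => shift (a + g) y j,
        fun j : Fin n => shift (a - n) x j))
      lia)
  have hu := S.mapsTo (-(a + g)) v.2
  have huy : ∀ i, a + g ≤ i → i < a + g + n → shift (-(a + g)) v.1 i = y i := fun i h1 h2 => by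
    have := congrFun hv ⟨(i - (a + g)).toNat, by lia⟩
    simp only [shift_apply] at this ⊢
    convert this using 2 <;> lia
  have hux : ∀ i, a - n ≤ i → i < a → x i = shift (-(a + g)) v.1 i := fun i h1 h2 => by
    have := congrFun hv' ⟨(i - (a - n)).toNat, by lia⟩
    simp only [shift_apply, subshiftHomeo_zpow_apply] at this ⊢
    rw [eq_comm]
    convert this using 2 <;> lia
  have mem : ∀ w, w ∈ S.carrier ↔ ∀ i : ℤ, (fun j : Fin n => w (i + (j : ℤ))) ∈ P := fun w => by
    rw [hP]; rfl
  have h1 := splice_mem ((mem x).mp hx) ((mem _).mp hu) hux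
  have h2 := splice_mem h1 ((mem y).mp hy) (a := a + g + n) fun i h1 h2 => by
    rw [splice_of_le _ _ (by lia)]
    exact huy i (by lia) h2
  refine ⟨_, (mem _).mpr h2, fun i hi => ?_, fun i hi => ?_⟩
  · rw [splice_of_lt _ _ (by lia), splice_of_lt _ _ hi]
  · rcases lt_or_ge i (a + g + n) with h | h
    · rw [splice_of_lt _ _ h, splice_of_le _ _ (by lia), huy i hi h]
    · exact splice_of_le _ _ h

end Gluing

/-! ### Rarity of words avoiding a pattern. -/

section Counting

variable {A : Type*}

/-- The points of `S` that agree with `z` outside `[0, m)`. -/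
def windowClass (S : Set (ℤ → A)) (z : ℤ → A) (m : ℕ) : Set (ℤ → A) :=
  {x ∈ S | ∀ i : ℤ, i < 0 ∨ m ≤ i → x i = z i}

/-- The points `x` of `S`, agreeing with `z` outside `[0, m)`, such that the word of length `l`
read in `w` at `0` does not occur in `x` at `g + i * p` for `i < k`. -/
def avoidingClass (S : Set (ℤ → A)) (z w : ℤ → A) (m g l p k : ℕ) : Set (ℤ → A) :=
  {x ∈ windowClass S z m | ∀ i : ℕ, i < k → ¬ ∀ t : ℕ, t < l → x (i * p + g + t) = w t}

theorem windowClass_finite [Finite A] (S : Set (ℤ → A)) (z : ℤ → A) (m : ℕ) :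
    (windowClass S z m).Finite := by
  refine Set.Finite.of_finite_image (f := fun x (j : Fin m) => x j) (Set.toFinite _) ?_
  intro x hx y hy h
  funext i
  by_cases hi : i < 0 ∨ m ≤ i
  · rw [hx.2 i hi, hy.2 i hi]
  · have := congrFun h ⟨i.toNat, by lia⟩
    simpa [Int.toNat_of_nonneg (show 0 ≤ i by lia)] using this

theorem avoidingClass_finite [Finite A] (S : Set (ℤ → A)) (z w : ℤ → A) (m g l p k : ℕ) :
    (avoidingClass S z w m g l p k).Finite :=
  (windowClass_finite S z m).subset fun _ hx => hx.1

/-- Rewrite block `k` so that it contains `w`, with a gap `g` on either side. The rewritten point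
together with the old content of the block recovers the original. -/
theorem ncard_avoidingClass_le [Finite A] {S : Set (ℤ → A)} {g : ℕ} (hS : HasGluing S g)
    (hshift : ∀ n : ℤ, Set.MapsTo (shift n) S S) (z : ℤ → A) {w : ℤ → A} (hw : w ∈ S)
    {m l k : ℕ} (hm : (k + 1) * (l + 2 * g) ≤ m) :
    (avoidingClass S z w m g l (l + 2 * g) k).ncard ≤
      (avoidingClass S z w m g l (l + 2 * g) k \
        avoidingClass S z w m g l (l + 2 * g) (k + 1)).ncard * Nat.card A ^ (l + 2 * g) := by
  set p := l + 2 * g with hp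
  set a : ℤ := k * p with ha
  have ham : a + p ≤ m := by rw [ha]; push_cast [← Nat.cast_le (α := ℤ)] at hm; lia
  have ha0 : 0 ≤ a := by positivity
  have hrep : ∀ x ∈ S, ∃ u ∈ S, (∀ i, i < a ∨ a + p ≤ i → u i = x i) ∧
      ∀ t : ℕ, t < l → u (a + g + t) = w t := fun x hx => by
    obtain ⟨u, hu, h1, h2, h3⟩ := hS.exists_three hx (hshift (-(a + g)) hw) hx
      (a := a) (b := a + g + l) (by lia)
    refine ⟨u, hu, fun i hi => hi.elim (h1 i) fun hi => h3 i (by lia), fun t ht => ?_⟩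
    rw [h2 _ (by lia) (by lia), shift_apply]
    congr 1; ring
  choose! ρ hρS hρx hρw using hrep
  rw [show Nat.card A ^ p = (Set.univ : Set (Fin p → A)).ncard by
      simp [Set.ncard_univ, Nat.card_fun],
    ← Set.ncard_prod]
  refine Set.ncard_le_ncard_of_injOn (fun x => (ρ x, fun j : Fin p => x (a + j))) ?_ ?_
    (((avoidingClass_finite S z w m g l p k).subset Set.sdiff_subset).prod Set.finite_univ)
  · rintro x ⟨⟨hxS, hxz⟩, hxk⟩
    refine ⟨⟨⟨⟨hρS x hxS, fun i hi => ?_⟩, fun i hi hc => hxk i hi fun t ht => ?_⟩, fun hc => ?_⟩,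
      trivial⟩
    · exact (hρx x hxS i (by lia)).trans (hxz i hi)
    · have : ((i : ℤ) + 1) * p ≤ k * p := mul_le_mul_of_nonneg_right (by lia) (by lia)
      exact (hρx x hxS _ (Or.inl (by lia))).symm.trans (hc t ht)
    · exact hc.2 k (Nat.lt_succ_self k) (hρw x hxS)
  · rintro x ⟨⟨hxS, -⟩, -⟩ y ⟨⟨hyS, -⟩, -⟩ h
    obtain ⟨h1, h2⟩ := Prod.ext_iff.mp h
    funext i
    by_cases hi : i < a ∨ a + p ≤ i
    · rw [← hρx x hxS i hi, ← hρx y hyS i hi]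
      exact congrFun h1 i
    · have := congrFun h2 ⟨(i - a).toNat, by lia⟩
      simp only at this
      convert this using 2 <;> lia

/-- Avoiding a word in `k` disjoint blocks is exponentially rare. -/
theorem pow_mul_ncard_avoidingClass_le [Finite A] {S : Set (ℤ → A)} {g : ℕ} (hS : HasGluing S g)
    (hshift : ∀ n : ℤ, Set.MapsTo (shift n) S S) (z : ℤ → A) {w : ℤ → A} (hw : w ∈ S)
    {m l k : ℕ} (hm : k * (l + 2 * g) ≤ m) :
    (Nat.card A ^ (l + 2 * g)) ^ k * (avoidingClass S z w m g l (l + 2 * g) k).ncard ≤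
      (Nat.card A ^ (l + 2 * g) - 1) ^ k * (windowClass S z m).ncard := by
  induction k with
  | zero =>
    simpa using Set.ncard_le_ncard (fun _ hx => hx.1) (windowClass_finite S z m)
  | succ k ih =>
    have ih := ih (le_trans (Nat.mul_le_mul_right _ k.le_succ) hm)
    have hstep := ncard_avoidingClass_le hS hshift z hw hm
    have hsub : avoidingClass S z w m g l (l + 2 * g) (k + 1) ⊆
        avoidingClass S z w m g l (l + 2 * g) k :=
      fun x hx => ⟨hx.1, fun i hi => hx.2 i (by lia)⟩
    rw [Set.ncard_sdiff hsub (avoidingClass_finite ..)] at hstep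
    have hle := Set.ncard_le_ncard hsub (avoidingClass_finite ..)
    set Q := Nat.card A ^ (l + 2 * g)
    set b := (avoidingClass S z w m g l (l + 2 * g) k).ncard
    set b' := (avoidingClass S z w m g l (l + 2 * g) (k + 1)).ncard
    -- Here `hstep` reads `b ≤ (b - b') * Q`.
    have key : Q * b' ≤ (Q - 1) * b := by
      rw [Nat.sub_mul] at hstep
      rw [Nat.sub_mul, one_mul, mul_comm Q, mul_comm Q]
      have := Nat.mul_le_mul_right Q hle
      lia
    calc Q ^ (k + 1) * b' = Q ^ k * (Q * b') := by ring
      _ ≤ Q ^ k * ((Q - 1) * b) := Nat.mul_le_mul_left _ key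
      _ = (Q - 1) * (Q ^ k * b) := by ring
      _ ≤ (Q - 1) * ((Q - 1) ^ k * _) := Nat.mul_le_mul_left _ ih
      _ = _ := by ring

theorem exists_mul_pred_pow_lt_pow (C : ℕ) {Q : ℕ} (hQ : 1 ≤ Q) :
    ∃ k : ℕ, C * (Q - 1) ^ k < Q ^ k := by
  have hQ' : (0 : ℝ) < Q := by exact_mod_cast hQ
  obtain ⟨k, hk⟩ := exists_pow_lt_of_lt_one (x := 1 / ((C : ℝ) + 1)) (y := ((Q : ℝ) - 1) / Q)
    (by positivity) (by rw [div_lt_one hQ']; linarith)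
  refine ⟨k, ?_⟩
  rw [div_pow, div_lt_div_iff₀ (by positivity) (by positivity), one_mul] at hk
  have h0 : (0 : ℝ) ≤ ((Q : ℝ) - 1) ^ k := pow_nonneg (by
    have : (1 : ℝ) ≤ Q := by exact_mod_cast hQ
    linarith) k
  rw [← Nat.cast_lt (α := ℝ)]
  push_cast [Nat.cast_sub hQ]
  nlinarith

theorem ncard_le_mul_ncard_image {α β : Type*} {s : Set α} (hs : s.Finite) {h : α → β} {K : ℕ}
    (hK : ∀ b, {a | h a = b}.encard ≤ K) : s.ncard ≤ K * (h '' s).ncard := by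
  classical
  lift s to Finset α using hs
  rw [← Finset.coe_image, Set.ncard_coe_finset, Set.ncard_coe_finset]
  refine Finset.card_le_mul_card_image s K fun b _ => ?_
  rw [← ENat.natCast_le_natCast, ← Set.encard_coe_eq_coe_finsetCard]
  exact (Set.encard_le_encard fun a ha => (Finset.mem_filter.mp ha).2).trans (hK b)

end Counting

/-! ### The two counts compared. -/

section Myhill

variable {A : Type*} [Finite A] [TopologicalSpace A] [DiscreteTopology A]
  {X : Type*} [MetricSpace X] {f : X ≃ₜ X}

/-- If every point of the range of `φ` lifts through `π` to points in which the word of length `l`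
read in `w` at `0` does not occur, then `φ` takes few values on the points that agree with `z`
outside `[0, m)`. -/
theorem exists_ncard_image_windowClass_le (hf : IsExpansive f) (S : Subshift A ℤ) {g : ℕ}
    (hS : HasGluing S.carrier g) {π φ : S.carrier → X} (hπ : IsFactorMap (subshiftHomeo S) f π)
    (hφ : Continuous φ) (hφf : ∀ y, φ (subshiftHomeo S y) = f (φ y)) {w : ℤ → A} {l : ℕ}
    (hw : ∀ s, π s ∈ Set.range φ → ∀ q : ℤ, ¬ ∀ t : ℕ, t < l → s.1 (q + t) = w t)
    {z : ℤ → A} (hz : z ∈ S.carrier) :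
    ∃ M : ℕ, ∀ m k : ℕ, k * (l + 2 * g) ≤ m → 2 * g ≤ m →
      (φ '' (Subtype.val ⁻¹' windowClass S.carrier z m)).ncard ≤
        (avoidingClass S.carrier z w m g l (l + 2 * g) k).ncard * M := by
  obtain ⟨δ, hδ, hexp⟩ := hf
  obtain ⟨c₁, hc₁⟩ := exists_agreement_dist_zpow_lt S hπ.continuous hπ.semiconj hδ
  obtain ⟨c₂, hc₂⟩ := exists_agreement_dist_zpow_lt S hφ hφf hδ
  set c := max c₁ c₂
  have hcc₁ : c₁ ≤ c := le_max_left _ _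
  have hcc₂ : c₂ ≤ c := le_max_right _ _
  -- The data lost in gluing: the words of the lift on `[-2c, g)` and on `[m - g, m + 2c)`.
  set E := Set.univ (α := (Fin (2 * c + g) → A) × (Fin (2 * c + g) → A))
  refine ⟨E.ncard, fun m k hk hm => ?_⟩
  set s : X → S.carrier := Function.surjInv hπ.surjective
  have hs : ∀ y, π (s y) = y := Function.surjInv_eq hπ.surjective
  have hglue : ∀ y, ∃ u ∈ S.carrier, (∀ i : ℤ, i < 0 → u i = z i) ∧
      (∀ i : ℤ, 0 + (g : ℤ) ≤ i → i < m - g → u i = (s y).1 i) ∧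
      ∀ i : ℤ, (m : ℤ) - g + g ≤ i → u i = z i :=
    fun y => hS.exists_three hz (s y).2 hz (by lia)
  choose u huS hu₁ hu₂ hu₃ using hglue
  rw [← Set.ncard_prod]
  refine Set.ncard_le_ncard_of_injOn
    (fun y => (u y, fun j => (s y).1 (j - 2 * c), fun j => (s y).1 (m - g + j))) ?_ ?_
    ((avoidingClass_finite ..).prod Set.finite_univ)
  · rintro y ⟨x, -, hxy⟩
    refine ⟨⟨⟨huS y, fun i hi => ?_⟩, fun i hi hc => ?_⟩, trivial⟩
    · exact hi.elim (hu₁ y i) fun hi => hu₃ y i (by lia)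
    · refine hw (s y) ⟨x, hxy.trans (hs y).symm⟩ (i * (l + 2 * g : ℕ) + g) fun t ht => ?_
      have h1 : ((i : ℤ) + 1) * (l + 2 * g : ℕ) ≤ k * (l + 2 * g : ℕ) :=
        mul_le_mul_of_nonneg_right (by lia) (by lia)
      have h2 : (k : ℤ) * (l + 2 * g : ℕ) ≤ m := by exact_mod_cast hk
      have h3 : 0 ≤ (i : ℤ) * (l + 2 * g : ℕ) := by positivity
      rw [← hc t ht]
      exact (hu₂ y _ (by lia) (by lia)).symm
  · rintro y ⟨x, hx, rfl⟩ y' ⟨x', hx', rfl⟩ h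
    obtain ⟨h₁, h₂₃⟩ := Prod.ext_iff.mp h
    obtain ⟨h₂, h₃⟩ := Prod.ext_iff.mp h₂₃
    have hss : ∀ i : ℤ, -2 * c ≤ i → i < m + 2 * c → (s (φ x)).1 i = (s (φ x')).1 i := by
      intro i hi hi'
      rcases lt_or_ge i g with hg | hg
      · have := congrFun h₂ ⟨(i + 2 * c).toNat, by lia⟩
        simp only at this
        convert this using 2 <;> lia
      rcases lt_or_ge i (m - g) with hg' | hg'
      · rw [← hu₂ _ i (by lia) hg', ← hu₂ _ i (by lia) hg']
        exact congrFun h₁ i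
      · have := congrFun h₃ ⟨(i - (m - g)).toNat, by lia⟩
        simp only at this
        convert this using 2 <;> lia
    by_contra hne
    obtain ⟨n, hn⟩ := hexp _ _ hne
    refine hn.not_gt ?_
    rw [← neg_neg n]
    -- If the window around `-n` misses `[0, m)`, then `x` and `x'` both equal `z` on it. Otherwise
    -- it lies in `[-2c, m + 2c)`, where the lifts agree.
    by_cases hq : -n + c < 0 ∨ m ≤ -n - c
    · refine hc₂ x x' (-n) fun i hi hi' => ?_
      rw [hx.2 i (by lia), hx'.2 i (by lia)]
    · rw [← hs (φ x), ← hs (φ x')]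
      exact hc₁ _ _ (-n) fun i hi hi' => hss i (by lia) (by lia)

theorem hasMyhillProperty_of_hasGluing [CompactSpace X] (hf : IsExpansive f) (S : Subshift A ℤ)
    {g : ℕ} (hS : HasGluing S.carrier g) {π : S.carrier → X}
    (hπ : IsFactorMap (subshiftHomeo S) f π) (hK : IsUniformlyBoundedToOne π) :
    HasMyhillProperty f := by
  intro τ hτ hinj
  by_contra hsurj
  obtain ⟨y₀, hy₀⟩ : ∃ y₀, y₀ ∉ Set.range τ := by
    simpa [Function.Surjective] using hsurj
  obtain ⟨z, rfl⟩ := hπ.surjective y₀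
  obtain ⟨K, -, hK⟩ := hK
  have hopen : IsOpen (π ⁻¹' (Set.range τ)ᶜ) :=
    (isCompact_range hτ.continuous).isClosed.isOpen_compl.preimage hπ.continuous
  obtain ⟨c, hc⟩ := exists_agreement_subset_of_isOpen hopen hy₀
  set φ : S.carrier → X := τ ∘ π
  have hφf : ∀ y, φ (subshiftHomeo S y) = f (φ y) := fun y => by
    simp only [φ, Function.comp_apply, hπ.semiconj, hτ.commute]
  have hφ : Continuous φ := hτ.continuous.comp hπ.continuous
  have hw : ∀ s, π s ∈ Set.range φ → ∀ q : ℤ,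
      ¬ ∀ t : ℕ, t < 2 * c + 1 → s.1 (q + t) = shift (-c : ℤ) z.1 t := by
    rintro s ⟨x, hx⟩ q hq
    refine hc ((subshiftHomeo S ^ (-(q + c))) s) (fun i hi => ?_)
      ⟨π ((subshiftHomeo S ^ (-(q + c))) x), ?_⟩
    · have hi := abs_le.mp hi
      have := hq (i + c).toNat (by lia)
      rw [shift_apply] at this
      rw [subshiftHomeo_zpow_apply]
      convert this using 2 <;> lia
    · exact (semiconj_zpow hφf _ x).trans (by rw [hx, semiconj_zpow hπ.semiconj])
  obtain ⟨M, hM⟩ := exists_ncard_image_windowClass_le hf S hS hπ hφ hφf hw z.2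
  have : Nonempty A := ⟨z.1 0⟩
  obtain ⟨k, hk⟩ := exists_mul_pred_pow_lt_pow (K * M)
    (Nat.one_le_pow (2 * c + 1 + 2 * g) (Nat.card A) Nat.card_pos)
  -- The summand `2 * g` leaves room for both gaps even when `k = 0`.
  set m := k * (2 * c + 1 + 2 * g) + 2 * g
  have hcount := pow_mul_ncard_avoidingClass_le hS S.mapsTo z.1 (S.mapsTo (-c) z.2)
    (m := m) (l := 2 * c + 1) (k := k) (by lia)
  have hM := hM m k (by lia) (by lia)
  set H := windowClass S.carrier z.1 m
  set H' : Set S.carrier := Subtype.val ⁻¹' H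
  have hHfin : H.Finite := windowClass_finite ..
  have hH'fin : H'.Finite := hHfin.preimage Subtype.val_injective.injOn
  have hHH' : H'.ncard = H.ncard :=
    Set.ncard_preimage_of_injective_subset_range Subtype.val_injective fun x hx => ⟨⟨x, hx.1⟩, rfl⟩
  have hHpos : 0 < H.ncard := (Set.ncard_pos hHfin).mpr ⟨z.1, z.2, fun _ _ => rfl⟩
  -- Pre-injectivity is used here, and only here.
  have hφπ : (φ '' H').ncard = (π '' H').ncard := by
    rw [Set.image_comp]
    refine Set.InjOn.ncard_image ?_
    rintro _ ⟨x, hx, rfl⟩ _ ⟨x', hx', rfl⟩ h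
    refine hinj _ _ (homoclinic_of_agreement S hπ.continuous hπ.semiconj (r := m) fun i hi => ?_) h
    have hi : i < 0 ∨ m ≤ i := by rcases abs_cases i with h | h <;> lia
    rw [hx.2 i hi, hx'.2 i hi]
  have hle := ncard_le_mul_ncard_image hH'fin hK
  rw [hHH', ← hφπ] at hle
  set Q := Nat.card A ^ (2 * c + 1 + 2 * g)
  set b := (avoidingClass S.carrier z.1 (shift (-c : ℤ) z.1) m g (2 * c + 1)
    (2 * c + 1 + 2 * g) k).ncard
  refine lt_irrefl (Q ^ k * H.ncard) ?_
  calc Q ^ k * H.ncard ≤ Q ^ k * (K * (b * M)) :=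
        Nat.mul_le_mul_left _ (hle.trans (Nat.mul_le_mul_left _ hM))
    _ = K * M * (Q ^ k * b) := by ring
    _ ≤ K * M * ((Q - 1) ^ k * H.ncard) := Nat.mul_le_mul_left _ hcount
    _ = K * M * (Q - 1) ^ k * H.ncard := by ring
    _ < Q ^ k * H.ncard := Nat.mul_lt_mul_of_pos_right hk hHpos

end Myhill

end GardenOfEden

theorem theorem4p1 {X : Type*} [MetricSpace X] [CompactSpace X] (f : X ≃ₜ X)
    (hf : GardenOfEden.IsExpansive f)
    {A : Type*} [Finite A] [TopologicalSpace A] [DiscreteTopology A]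
    (S : SymbolicDynamics.FullShift.Subshift A ℤ)
    (hSft : GardenOfEden.IsOfFiniteType S)
    (hMix : GardenOfEden.IsTopologicallyMixing (GardenOfEden.subshiftHomeo S))
    (π : S.carrier → X)
    (hπ : GardenOfEden.IsFactorMap (GardenOfEden.subshiftHomeo S) f π)
    (hK : GardenOfEden.IsUniformlyBoundedToOne π) :
    GardenOfEden.HasMyhillProperty f := by
  obtain ⟨g, hg⟩ := GardenOfEden.exists_hasGluing S hSft hMix
  exact GardenOfEden.hasMyhillProperty_of_hasGluing hf S hg hπ hK
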